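/- For an integer $n\ge 1$, let $K_n$ be the knot obtained as the closure of the positive $4$-braid $$\sigma_3\sigma_2\sigma_2\sigma_1\sigma_3\sigma_2\sigma_2\sigma_3\sigma_2\,(\sigma_1\sigma_2)^{3n},$$ where $\sigma_1,\sigma_2,\sigma_3$ are the standard generators of the braid group $B_4$ on four strands. Then the Alexander polynomial of $K_n$, which is defined up to multiplication by a unit $\pm t^k$ of $\mathbb{Z}[t,t^{-1}]$, is $$\Delta_{K_n}(t)=(t^{6n+6}-t^{6n+5})+\sum_{i=0}^{n-1}\left(t^{3n+3i+5}-t^{3n+3i+4}\right)+t^{3n+3}-\sum_{i=0}^{n-1}\left(t^{3i+5}-t^{3i+4}\right)-t+1 .$$ -/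

import Mathlib

open scoped LaurentPolynomial Polynomial

noncomputable section

namespace KnotTheory

/-! ### Fox calculus over `ℤ[t, t⁻¹]` -/

/-- The Fox derivative `∂w/∂x_j` of a word `w` in the letters `x_i`, `x_i⁻¹` (encoded, as in
`FreeGroup`, by `(i, true)`, `(i, false)`), with coefficients pushed forward to `ℤ[t, t⁻¹]` by
`x_i ↦ t` for every `i`.  It is computed by the rules `∂1 = 0`,
`∂(x_i w) = δ_ij + t ∂w` and `∂(x_i⁻¹ w) = -t⁻¹ δ_ij + t⁻¹ ∂w`. -/
def foxWord {ι : Type} [DecidableEq ι] (j : ι) : List (ι × Bool) → ℤ[T;T⁻¹]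
  | [] => 0
  | (i, true) :: w => (if i = j then 1 else 0) + LaurentPolynomial.T 1 * foxWord j w
  | (i, false) :: w =>
      -(LaurentPolynomial.T (-1) * (if i = j then 1 else 0))
        + LaurentPolynomial.T (-1) * foxWord j w

theorem foxWord_step {ι : Type} [DecidableEq ι] (j : ι) {v w : List (ι × Bool)}
    (h : FreeGroup.Red.Step v w) : foxWord j v = foxWord j w := by
  obtain ⟨⟩ := h
  rename_i L₁ L₂ x b
  induction L₁ with
  | nil =>
    have h₁ : (LaurentPolynomial.T 1 * LaurentPolynomial.T (-1) : ℤ[T;T⁻¹]) = 1 := by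
      rw [← LaurentPolynomial.T_add]; simp
    cases b <;> simp only [List.nil_append, foxWord, Bool.not_true, Bool.not_false]
    · linear_combination (foxWord j L₂) * h₁
    · linear_combination (foxWord j L₂ - if x = j then 1 else 0) * h₁
  | cons a L ih =>
    obtain ⟨i, c⟩ := a
    cases c <;> simp only [List.cons_append, foxWord, ih]

/-- The Fox derivative `∂/∂x_j` on the free group, with coefficients in `ℤ[t, t⁻¹]`. -/
def fox {ι : Type} [DecidableEq ι] (j : ι) : FreeGroup ι → ℤ[T;T⁻¹] :=
  Quot.lift (foxWord j) fun _ _ h => foxWord_step j h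

/-- The Alexander matrix `(∂r_k/∂x_j)` of a group presentation `⟨x_j | r_k⟩` all of whose
generators are sent to `t`. -/
def alexanderMatrix {ι κ : Type} [DecidableEq ι] (r : κ → FreeGroup ι) :
    Matrix κ ι ℤ[T;T⁻¹] :=
  Matrix.of fun k j => fox j (r k)

/-- The `d`-th elementary ideal of a matrix with `N` columns: the ideal generated by the
minors of size `N - d`. (Choices of rows or columns with a repetition contribute `0`; if
`N ≤ d` the only minor is the empty one, which is `1`.) -/
def elementaryIdeal {R ι κ : Type} [CommRing R] [Fintype ι] (A : Matrix κ ι R) (d : ℕ) :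
    Ideal R :=
  Ideal.span {x | ∃ (f : Fin (Fintype.card ι - d) → κ) (g : Fin (Fintype.card ι - d) → ι),
    x = (A.submatrix f g).det}

/-! ### Closed braids and their Wirtinger presentations -/

/-- A word in the standard generators of the braid group on `m + 1` strands: the letter
`(i, true)` is the generator exchanging the strands in the adjacent positions `i.castSucc` and
`i.succ` (positions are counted from `0`, from left to right) at a positive crossing, and
`(i, false)` is its inverse. -/
abbrev BraidWord (m : ℕ) : Type := List (Fin m × Bool)

/-- The pieces into which the standard diagram of the closure of the braid word `w` is cut by
the horizontal levels `0, …, w.length`: `(k, p)` is the point of the diagram in position `p` at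
level `k`, where the `k`-th letter is drawn between the levels `k` and `k + 1`. All strands run
from level `0` to level `w.length`, where they return to level `0` around the braid axis. -/
abbrev Piece {m : ℕ} (w : BraidWord m) : Type := Fin (w.length + 1) × Fin (m + 1)

/-- The Wirtinger rule at a single letter: if the meridians of the strands entering from below
are `x p`, this gives the meridians of the strands that leave above.

At a positive crossing in the positions `i, i + 1` (strands oriented upwards) the strand from
`i` to `i + 1` passes over, and the one from `i + 1` to `i` passes under it from right to left;
the meridian `b` of the latter becomes `a⁻¹ b a`, where `a` is the meridian of the overpass.
At a negative crossing the strand from `i + 1` to `i` passes over, and the meridian `a` of the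
other becomes `b a b⁻¹`, where `b` is the meridian of the overpass. -/
def wirtingerStep {m : ℕ} {G : Type} [Group G] (s : Fin m × Bool) (x : Fin (m + 1) → G) :
    Fin (m + 1) → G := fun p =>
  let a := x s.1.castSucc
  let b := x s.1.succ
  if p = s.1.castSucc then (if s.2 then a⁻¹ * b * a else b)
  else if p = s.1.succ then (if s.2 then a else b * a * b⁻¹)
  else x p

/-- The relators of the Wirtinger presentation of the closure of the braid word `w`. The
generators are the meridians of the pieces; there is one relator for each letter and position,
and one for each position that closes up the braid. -/
def wirtingerRelator {m : ℕ} (w : BraidWord m) :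
    (Fin w.length × Fin (m + 1)) ⊕ Fin (m + 1) → FreeGroup (Piece w)
  | .inl (k, p) =>
      FreeGroup.of (k.succ, p) *
        (wirtingerStep (w.get k) (fun q => FreeGroup.of ((k.castSucc, q) : Piece w)) p)⁻¹
  | .inr p => FreeGroup.of (Fin.last w.length, p) * (FreeGroup.of ((0, p) : Piece w))⁻¹

/-- The group of the closure of the braid word `w`, by its Wirtinger presentation. -/
abbrev ClosureGroup {m : ℕ} (w : BraidWord m) : Type :=
  PresentedGroup (Set.range (wirtingerRelator w))

/-- The first elementary ideal of the closure of the braid word `w`. -/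
def alexanderIdeal {m : ℕ} (w : BraidWord m) : Ideal ℤ[T;T⁻¹] :=
  elementaryIdeal (alexanderMatrix (wirtingerRelator w)) 1

/-- `Δ` is an Alexander polynomial of the closure of the braid word `w`: a greatest common
divisor of the first elementary ideal of the Wirtinger presentation, in other words, a generator
of the smallest principal ideal that contains it. As usual, `Δ` is determined exactly up to
multiplication by the units `±tᵏ` of `ℤ[t, t⁻¹]`. -/
def IsAlexanderPolynomial {m : ℕ} (w : BraidWord m) (Δ : ℤ[T;T⁻¹]) : Prop :=
  ∀ f : ℤ[T;T⁻¹], f ∣ Δ ↔ ∀ g ∈ alexanderIdeal w, f ∣ g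

/-- The positive braid word on four strands with the given letters; the letters `0, 1, 2` stand
for the standard generators `σ₁, σ₂, σ₃`. -/
def positiveWord (l : List (Fin 3)) : BraidWord 3 := l.map fun i => (i, true)

/-- The word `σ₃ σ₂ σ₂ σ₁ σ₃ σ₂ σ₂ σ₃ σ₂ (σ₁ σ₂)^{3n}`, whose closure is the knot `K_n`. -/
def knotK (n : ℕ) : BraidWord 3 :=
  positiveWord ([2, 1, 1, 0, 2, 1, 1, 2, 1] ++ (List.replicate (3 * n) [0, 1]).flatten)

end KnotTheory

end

/-!
The Alexander polynomial of a closed braid is computed from its Burau matrix `burau w`.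

The Alexander matrix of the Wirtinger presentation is square, its columns sum to zero
(`alexanderMatrix_mulVec_one`), and its rows sum to zero after multiplication by units
(`vecMul_alexanderMatrix`). Over a domain this makes all entries of the adjugate equal up to units,
so the first elementary ideal is generated by any one of them
(`elementaryIdeal_one_eq_span_adjugate`). Each Wirtinger relator of a letter expresses the meridians
above the letter by those below it; eliminating all meridians above level `0` in this way is a
multiplication by a unitriangular matrix, and it turns a suitable cofactor of the Alexander matrix
into a cofactor of the matrix `burau w - 1`, whose size is the number of strands
(`adjugate_alexanderMatrix_inr_inr`).

For `K_n` the Burau matrix is a power of that of the full twist `(σ₁σ₂)³` times a fixed matrix. With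
`s = t⁻¹`, the full twist has the Burau matrix `C` with `(C - 1)² = (s³ - 1)(C - 1)`, whence
`C ^ n = 1 + g (C - 1)` for `g = 1 + s³ + ⋯ + s^(3(n-1))` (`one_add_fullTwistSubOne_pow`). The
cofactor is then a polynomial in `s` and `g`, namely `-s³` times the claimed polynomial at `s`
(`adjugate_fullTwist_mul_prefix`), and that polynomial is palindromic
(`alexander_formula_palindromic`).
-/

namespace KnotTheory

noncomputable section

open LaurentPolynomial (T)

/-! ### Minors of corank one -/

section Minors

variable {R n : Type*} [CommRing R] [Fintype n] [DecidableEq n]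

theorem adjugate_apply_eq_of_mulVec_one_eq_zero [IsDomain R] {A : Matrix n n R}
    (h : A.mulVec 1 = 0) (i i' j : n) : A.adjugate i j = A.adjugate i' j := by
  rw [Matrix.adjugate_apply, Matrix.adjugate_apply]
  have key : (A.updateRow j (Pi.single i 1 + (-1 : R) • Pi.single i' 1)).det = 0 := by
    rw [← Matrix.exists_mulVec_eq_zero_iff]
    refine ⟨1, fun h0 => one_ne_zero (congrFun h0 j), ?_⟩
    ext k
    by_cases hk : k = j
    · subst hk
      simp [Matrix.mulVec, dotProduct, Finset.sum_add_distrib]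
    · simpa [Matrix.mulVec, hk] using congrFun h k
  rw [Matrix.det_updateRow_add, Matrix.det_updateRow_smul] at key
  linear_combination key

theorem mul_adjugate_apply_eq_of_vecMul_eq_zero [IsDomain R] {A : Matrix n n R} {v : n → R}
    (hv : v ≠ 0) (h : Matrix.vecMul v A = 0) (i j j' : n) :
    v j' * A.adjugate i j = v j * A.adjugate i j' := by
  have hadj : ∀ k, A.adjugate i k = (A.updateCol i (Pi.single k 1)).det := fun k => by
    rw [← Matrix.transpose_apply A.adjugate, Matrix.adjugate_transpose, Matrix.adjugate_apply,
      ← Matrix.det_transpose, Matrix.updateRow_transpose, Matrix.transpose_transpose]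
  rw [hadj, hadj]
  have key : (A.updateCol i (v j' • Pi.single j 1 + (-v j) • Pi.single j' 1)).det = 0 := by
    rw [← Matrix.exists_vecMul_eq_zero_iff]
    refine ⟨v, hv, ?_⟩
    ext k
    by_cases hk : k = i
    · subst hk
      simp [Matrix.vecMul, dotProduct, Finset.sum_add_distrib, mul_add, Pi.single_apply, mul_comm]
    · simpa [Matrix.vecMul, dotProduct, hk] using congrFun h k
  rw [Matrix.det_updateCol_add, Matrix.det_updateCol_smul, Matrix.det_updateCol_smul] at key
  linear_combination key

theorem associated_det_submatrix_equiv {m : Type*} [Fintype m] [DecidableEq m] (A : Matrix n n R)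
    (e₁ e₂ : m ≃ n) : Associated (A.submatrix e₁ e₂).det A.det := by
  have h : A.submatrix e₁ e₂ = (A.submatrix (e₂.symm.trans e₁) id).submatrix e₂ e₂ := by
    ext; simp
  rw [h, Matrix.det_submatrix_equiv_self, Matrix.det_permute]
  refine associated_unit_mul_left _ _ ?_
  exact (Units.isUnit (Equiv.Perm.sign (e₂.symm.trans e₁))).map (Int.castRingHom R)

/-- Cofactor expansion along arbitrary enumerations: deleting the row `e₁ (inr ())` and the
column `e₂ (inr ())` computes an entry of the adjugate up to sign. -/
theorem associated_det_submatrix_adjugate {m : Type*} [Fintype m] [DecidableEq m]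
    (A : Matrix n n R) (e₁ e₂ : m ⊕ Unit ≃ n) :
    Associated (A.submatrix (e₁ ∘ Sum.inl) (e₂ ∘ Sum.inl)).det
      (A.adjugate (e₂ (.inr ())) (e₁ (.inr ()))) := by
  rw [Matrix.adjugate_apply]
  refine Associated.trans ?_ (associated_det_submatrix_equiv _ e₁ e₂)
  have h : (A.updateRow (e₁ (.inr ())) (Pi.single (e₂ (.inr ())) 1)).submatrix e₁ e₂ =
      Matrix.fromBlocks (A.submatrix (e₁ ∘ Sum.inl) (e₂ ∘ Sum.inl))
        (A.submatrix (e₁ ∘ Sum.inl) (e₂ ∘ Sum.inr)) 0 1 := by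
    ext (i | i) (j | j) <;> simp [Matrix.updateRow_apply]
  rw [h, Matrix.det_fromBlocks_zero₂₁, Matrix.det_one, mul_one]

theorem exists_sumUnit_equiv_extending {m : Type*} [Fintype m]
    (hm : Fintype.card m + 1 = Fintype.card n) {f : m → n} (hf : f.Injective) :
    ∃ e : m ⊕ Unit ≃ n, e ∘ Sum.inl = f := by
  obtain ⟨x, hx⟩ : ∃ x, ∀ a, f a ≠ x := by
    by_contra! h
    have := Fintype.card_le_of_surjective f h
    omega
  have hinj : (Sum.elim f fun _ : Unit => x).Injective :=
    hf.sumElim (fun _ _ _ => rfl) fun a _ => hx a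
  exact ⟨Equiv.ofBijective _ ((Fintype.bijective_iff_injective_and_card _).2
    ⟨hinj, by simpa using hm⟩), rfl⟩

theorem exists_sumUnit_equiv_apply_inr {m : Type*} [Fintype m]
    (hm : Fintype.card m + 1 = Fintype.card n) (i : n) :
    ∃ e : m ⊕ Unit ≃ n, e (.inr ()) = i := by
  have e : m ⊕ Unit ≃ n := Fintype.equivOfCardEq (by simpa using hm)
  exact ⟨e.trans (Equiv.swap (e (.inr ())) i), by simp⟩

/-- If the columns of a square matrix over a domain sum to zero, and so do its rows after
multiplication by units, then all its minors of corank one agree up to units; hence each entry of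
the adjugate generates the first elementary ideal. -/
theorem elementaryIdeal_one_eq_span_adjugate {R κ ι : Type} [CommRing R] [IsDomain R] [Fintype κ]
    [Fintype ι] [DecidableEq κ] (A : Matrix κ ι R) (e : κ ≃ ι) (h1 : A.mulVec 1 = 0)
    {v : κ → R} (hu : ∀ k, IsUnit (v k)) (hv : Matrix.vecMul v A = 0) (i j : κ) :
    elementaryIdeal A 1 = Ideal.span {(A.submatrix id e).adjugate i j} := by
  set B := A.submatrix id e with hB
  have hB1 : B.mulVec 1 = 0 := by
    ext k
    have := congrFun h1 k
    simp only [Matrix.mulVec, dotProduct, Pi.one_apply, mul_one] at this ⊢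
    rw [← this]
    exact e.sum_comp fun l => A k l
  have hBv : Matrix.vecMul v B = 0 := by
    ext k
    exact congrFun hv (e k)
  have hv0 : v ≠ 0 := fun h0 => (hu i).ne_zero (congrFun h0 i)
  have hassoc : ∀ i' j', Associated (B.adjugate i' j') (B.adjugate i j) := fun i' j' => by
    rw [adjugate_apply_eq_of_mulVec_one_eq_zero hB1 i' i]
    have h := mul_adjugate_apply_eq_of_vecMul_eq_zero hv0 hBv i j' j
    have h₁ := associated_unit_mul_left (B.adjugate i j') _ (hu j)
    rw [h] at h₁
    exact h₁.symm.trans (associated_unit_mul_left _ _ (hu j'))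
  have hm : Fintype.card (Fin (Fintype.card ι - 1)) + 1 = Fintype.card κ := by
    have : 0 < Fintype.card ι := Fintype.card_pos_iff.2 ⟨e i⟩
    rw [Fintype.card_fin, Fintype.card_congr e]
    omega
  apply le_antisymm
  · refine Ideal.span_le.2 ?_
    rintro _ ⟨f, g, rfl⟩
    rw [SetLike.mem_coe, Ideal.mem_span_singleton]
    by_cases hf : f.Injective
    · by_cases hg : g.Injective
      · obtain ⟨e₁, rfl⟩ := exists_sumUnit_equiv_extending hm hf
        obtain ⟨e₂, he₂⟩ := exists_sumUnit_equiv_extending hm (e.symm.injective.comp hg)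
        have h := (associated_det_submatrix_adjugate B e₁ e₂).trans (hassoc _ _)
        rw [he₂] at h
        have hS : A.submatrix (e₁ ∘ Sum.inl) g =
            B.submatrix (e₁ ∘ Sum.inl) (e.symm ∘ g) := by ext; simp [hB]
        rw [hS]
        exact h.symm.dvd
      · obtain ⟨a, b, hab, hne⟩ := Function.not_injective_iff.1 hg
        rw [Matrix.det_zero_of_column_eq hne fun k => by simp [hab]]
        exact dvd_zero _
    · obtain ⟨a, b, hab, hne⟩ := Function.not_injective_iff.1 hf
      rw [Matrix.det_zero_of_row_eq hne (by ext; simp [hab])]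
      exact dvd_zero _
  · rw [Ideal.span_singleton_le_iff_mem]
    obtain ⟨e₁, h₁⟩ := exists_sumUnit_equiv_apply_inr hm j
    obtain ⟨e₂, h₂⟩ := exists_sumUnit_equiv_apply_inr hm i
    have h := associated_det_submatrix_adjugate B e₁ e₂
    rw [h₁, h₂] at h
    refine Ideal.mem_of_dvd _ h.dvd (Ideal.subset_span ⟨e₁ ∘ Sum.inl, e ∘ e₂ ∘ Sum.inl, ?_⟩)
    congr 1

end Minors

/-! ### The Burau matrix -/

/-- The abelianized action of one letter of a braid word on the meridians: row `p` holds the Fox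
derivatives of `wirtingerStep s x p` with respect to the meridians `x q` that enter. This is
the unreduced Burau matrix of the letter, acting on columns. -/
def burauLetter {m : ℕ} (s : Fin m × Bool) : Matrix (Fin (m + 1)) (Fin (m + 1)) ℤ[T;T⁻¹] :=
  Matrix.of fun p =>
    let a : Fin (m + 1) → ℤ[T;T⁻¹] := Pi.single s.1.castSucc 1
    let b : Fin (m + 1) → ℤ[T;T⁻¹] := Pi.single s.1.succ 1
    if p = s.1.castSucc then (if s.2 then (1 - T (-1) : ℤ[T;T⁻¹]) • a + (T (-1) : ℤ[T;T⁻¹]) • b else b)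
    else if p = s.1.succ then (if s.2 then a else (T 1 : ℤ[T;T⁻¹]) • a + (1 - T 1 : ℤ[T;T⁻¹]) • b)
    else Pi.single p 1

/-- The Burau matrix of a braid word; the first letter acts first, hence stands rightmost. -/
def burau {m : ℕ} : BraidWord m → Matrix (Fin (m + 1)) (Fin (m + 1)) ℤ[T;T⁻¹]
  | [] => 1
  | s :: w => burau w * burauLetter s

theorem burau_append {m : ℕ} (u w : BraidWord m) : burau (u ++ w) = burau w * burau u := by
  induction u with
  | nil => simp [burau]
  | cons s u ih => simp [burau, ih, mul_assoc]

theorem burau_take_succ {m : ℕ} (w : BraidWord m) (k : Fin w.length) :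
    burau (w.take (k + 1)) = burauLetter (w.get k) * burau (w.take k) := by
  rw [List.take_succ_eq_append_getElem k.isLt, burau_append]
  simp [burau]

theorem T_mul_T_neg_one : (T 1 * T (-1) : ℤ[T;T⁻¹]) = 1 := by
  rw [← LaurentPolynomial.T_add]; simp

theorem burauLetter_mulVec_one {m : ℕ} (s : Fin m × Bool) : (burauLetter s).mulVec 1 = 1 := by
  ext1 p
  simp only [burauLetter, Matrix.mulVec, Matrix.of_apply, dotProduct_one, Pi.one_apply]
  split_ifs <;> simp [Finset.sum_add_distrib, ← Finset.mul_sum, ← Finset.sum_mul]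

theorem castSucc_ne_succ {m : ℕ} (i : Fin m) : i.castSucc ≠ i.succ :=
  (Fin.castSucc_lt_succ).ne

/-- The weights `t^(-p)` are invariant under the Burau matrices. -/
theorem vecMul_burauLetter {m : ℕ} (s : Fin m × Bool) :
    Matrix.vecMul (fun p : Fin (m + 1) => (T (-(p : ℤ)) : ℤ[T;T⁻¹])) (burauLetter s) =
      fun p : Fin (m + 1) => (T (-(p : ℤ)) : ℤ[T;T⁻¹]) := by
  obtain ⟨i, c⟩ := s
  have hT : (T (-(i.succ : ℕ)) : ℤ[T;T⁻¹]) = T (-1) * T (-(i.castSucc : ℕ)) := by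
    rw [← LaurentPolynomial.T_add]; congr 1; simp
  have hne := castSucc_ne_succ i
  ext1 q
  -- only the rows `i` and `i + 1` differ from those of the identity matrix
  have hrow : ∀ p, burauLetter (i, c) p q = (1 : Matrix _ _ ℤ[T;T⁻¹]) p q
      + (if p = i.castSucc then burauLetter (i, c) i.castSucc q
          - (1 : Matrix _ _ ℤ[T;T⁻¹]) i.castSucc q else 0)
      + (if p = i.succ then burauLetter (i, c) i.succ q
          - (1 : Matrix _ _ ℤ[T;T⁻¹]) i.succ q else 0) := fun p => by
    by_cases h1 : p = i.castSucc
    · subst h1; simp [hne]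
    · by_cases h2 : p = i.succ
      · subst h2; simp [hne.symm]
      · simp [burauLetter, h1, h2, Matrix.one_apply, Pi.single_apply, eq_comm]
  simp only [Matrix.vecMul, dotProduct]
  rw [Finset.sum_congr rfl fun p _ => by rw [hrow p]]
  simp only [mul_add, Finset.sum_add_distrib, mul_ite, mul_zero, Finset.sum_ite_eq',
    Finset.mem_univ, if_true, Matrix.one_apply, mul_one]
  rw [add_assoc]
  apply add_eq_left.2
  rw [hT]
  cases c <;> simp only [burauLetter, Matrix.of_apply, hne.symm, if_true, if_false,
    Bool.false_eq_true, Pi.add_apply, Pi.smul_apply, smul_eq_mul, Pi.single_apply, eq_comm (a := q)]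
  · linear_combination (T (-(i.castSucc : ℕ)) * ((if i.castSucc = q then 1 else 0)
      - if i.succ = q then 1 else 0)) * T_mul_T_neg_one
  · ring

/-! ### The Alexander matrix of a closed braid -/

/-- The Fox derivatives of the relator that equates a new meridian `x` with the one that the
Wirtinger rule prescribes. -/
theorem fox_mul_wirtingerStep_inv {m : ℕ} {ι : Type} [DecidableEq ι] (s : Fin m × Bool)
    (x : ι) (y : Fin (m + 1) → ι) (p : Fin (m + 1)) (j : ι) :
    fox j (FreeGroup.of x * (wirtingerStep s (fun q => FreeGroup.of (y q)) p)⁻¹) =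
      (if x = j then 1 else 0) - ∑ q, burauLetter s p q * (if y q = j then 1 else 0) := by
  have h1 : ∀ a, fox j (FreeGroup.of x * (FreeGroup.of a)⁻¹) =
      (if x = j then 1 else 0) - (if a = j then 1 else 0) := fun a => by
    change foxWord j [(x, true), (a, false)] = _
    simp only [foxWord]
    linear_combination (-if a = j then 1 else 0) * T_mul_T_neg_one
  have h2 : ∀ a b, fox j (FreeGroup.of x * ((FreeGroup.of a)⁻¹ * FreeGroup.of b * FreeGroup.of a)⁻¹)
      = (if x = j then 1 else 0) - ((1 - T (-1)) * (if a = j then 1 else 0) +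
          T (-1) * (if b = j then 1 else 0)) := fun a b => by
    change foxWord j [(x, true), (a, false), (b, false), (a, true)] = _
    simp only [foxWord]
    linear_combination (-(if a = j then 1 else 0) + T (-1) * (if a = j then 1 else 0)
      - T (-1) * if b = j then 1 else 0) * T_mul_T_neg_one
  have h3 : ∀ a b, fox j (FreeGroup.of x * (FreeGroup.of b * FreeGroup.of a * (FreeGroup.of b)⁻¹)⁻¹)
      = (if x = j then 1 else 0) - (T 1 * (if a = j then 1 else 0) +
          (1 - T 1) * (if b = j then 1 else 0)) := fun a b => by
    change foxWord j [(x, true), (b, true), (a, false), (b, false)] = _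
    simp only [foxWord]
    linear_combination (-T 1 * (if a = j then 1 else 0)
      - (T 1 * T (-1) + 1) * if b = j then 1 else 0) * T_mul_T_neg_one
  obtain ⟨i, c⟩ := s
  simp only [wirtingerStep, burauLetter, Matrix.of_apply]
  have hsum : ∀ a : Fin (m + 1), ∑ q, (Pi.single a 1 : Fin (m + 1) → ℤ[T;T⁻¹]) q *
      (if y q = j then 1 else 0) = if y a = j then 1 else 0 := fun a => by
    simp only [Pi.single_apply, ite_mul, one_mul, zero_mul, Finset.sum_ite_eq', Finset.mem_univ,
      if_true]
  by_cases hp : p = i.castSucc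
  · cases c
    · simp only [hp, if_true, Bool.false_eq_true, if_false, h1, hsum]
    · simp only [hp, if_true, h2, Pi.add_apply, Pi.smul_apply, smul_eq_mul, add_mul,
        Finset.sum_add_distrib]
      simp only [mul_assoc, ← Finset.mul_sum, hsum]
  · by_cases hp' : p = i.succ
    · cases c
      · simp only [hp', (castSucc_ne_succ i).symm, if_true, if_false, Bool.false_eq_true, h3,
          Pi.add_apply, Pi.smul_apply, smul_eq_mul, add_mul, Finset.sum_add_distrib]
        simp only [mul_assoc, ← Finset.mul_sum, hsum]
      · simp only [hp', (castSucc_ne_succ i).symm, if_true, if_false, h1, hsum]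
    · simp only [hp, hp', if_false, h1, hsum]

theorem alexanderMatrix_inl {m : ℕ} (w : BraidWord m) (k : Fin w.length) (p : Fin (m + 1))
    (l : Fin (w.length + 1)) (q : Fin (m + 1)) :
    alexanderMatrix (wirtingerRelator w) (.inl (k, p)) (l, q) =
      (if k.succ = l then (1 : Matrix _ _ ℤ[T;T⁻¹]) p q else 0)
        - (if k.castSucc = l then burauLetter (w.get k) p q else 0) := by
  refine (fox_mul_wirtingerStep_inv (w.get k) (k.succ, p) (fun q => (k.castSucc, q)) p
    (l, q)).trans ?_
  simp only [Prod.mk.injEq, Matrix.one_apply, ite_and, mul_ite, mul_one, mul_zero]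
  split_ifs <;> simp

theorem alexanderMatrix_inr {m : ℕ} (w : BraidWord m) (p : Fin (m + 1))
    (l : Fin (w.length + 1)) (q : Fin (m + 1)) :
    alexanderMatrix (wirtingerRelator w) (.inr p) (l, q) =
      (if Fin.last _ = l then (1 : Matrix _ _ ℤ[T;T⁻¹]) p q else 0)
        - (if 0 = l then (1 : Matrix _ _ ℤ[T;T⁻¹]) p q else 0) := by
  change foxWord (l, q) [((Fin.last _, p), true), ((0, p), false)] = _
  simp only [foxWord, Prod.mk.injEq, Matrix.one_apply, ite_and]
  linear_combination (-if 0 = l then (if p = q then 1 else 0) else 0) * T_mul_T_neg_one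

theorem alexanderMatrix_mulVec_one {m : ℕ} (w : BraidWord m) :
    (alexanderMatrix (wirtingerRelator w)).mulVec 1 = 0 := by
  ext1 k
  rw [Matrix.mulVec, dotProduct_one, Fintype.sum_prod_type]
  obtain ⟨k, p⟩ | p := k
  · have h := congrFun (burauLetter_mulVec_one (w.get k)) p
    rw [Matrix.mulVec, dotProduct_one] at h
    simp only [alexanderMatrix_inl]
    rw [Finset.sum_comm]
    simp only [Finset.sum_sub_distrib, Finset.sum_ite_eq, Finset.mem_univ, if_true, h]
    simp [Matrix.one_apply]
  · simp only [alexanderMatrix_inr]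
    rw [Finset.sum_comm]
    simp [Finset.sum_sub_distrib]

theorem sum_fin_succ_sub_castSucc {R : Type*} [CommRing R] {L : ℕ} (h : Fin (L + 1) → R) :
    ∑ k : Fin L, (h k.succ - h k.castSucc) = h (Fin.last L) - h 0 := by
  have h1 := Fin.sum_univ_succ h
  rw [Fin.sum_univ_castSucc] at h1
  rw [Finset.sum_sub_distrib]
  linear_combination -h1

/-- The weights `t^(-p)` annihilate the Alexander matrix from the left when the closing relators
are counted negatively: along the braid the contributions telescope. -/
theorem vecMul_alexanderMatrix {m : ℕ} (w : BraidWord m) :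
    Matrix.vecMul (Sum.elim (fun kp : Fin w.length × Fin (m + 1) => (T (-(kp.2 : ℤ)) : ℤ[T;T⁻¹]))
        fun p : Fin (m + 1) => -(T (-(p : ℤ)) : ℤ[T;T⁻¹]))
      (alexanderMatrix (wirtingerRelator w)) = 0 := by
  ext1 ⟨l, q⟩
  have hB : ∀ k : Fin w.length, ∑ p : Fin (m + 1), (T (-(p : ℤ)) : ℤ[T;T⁻¹]) *
      burauLetter (w.get k) p q = T (-(q : ℤ)) := fun k =>
    congrFun (vecMul_burauLetter (w.get k)) q
  have h1 : ∑ p : Fin (m + 1), (T (-(p : ℤ)) : ℤ[T;T⁻¹]) *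
      (1 : Matrix _ _ ℤ[T;T⁻¹]) p q = T (-(q : ℤ)) := by simp [Matrix.one_apply]
  have hin : ∀ k : Fin w.length, ∑ p : Fin (m + 1), (T (-(p : ℤ)) : ℤ[T;T⁻¹]) *
      alexanderMatrix (wirtingerRelator w) (.inl (k, p)) (l, q) =
      (if k.succ = l then T (-(q : ℤ)) else 0) - (if k.castSucc = l then T (-(q : ℤ)) else 0) :=
    fun k => by
      simp only [alexanderMatrix_inl, mul_sub, Finset.sum_sub_distrib, mul_ite, mul_zero]
      split_ifs <;> simp only [hB, h1, Finset.sum_const_zero]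
  have hout : ∑ p : Fin (m + 1), (T (-(p : ℤ)) : ℤ[T;T⁻¹]) *
      alexanderMatrix (wirtingerRelator w) (.inr p) (l, q) =
      (if Fin.last _ = l then T (-(q : ℤ)) else 0) - (if 0 = l then T (-(q : ℤ)) else 0) := by
    simp only [alexanderMatrix_inr, mul_sub, Finset.sum_sub_distrib, mul_ite, mul_zero]
    split_ifs <;> simp only [h1, Finset.sum_const_zero]
  simp only [Matrix.vecMul, dotProduct, Fintype.sum_sum_type, Fintype.sum_prod_type, Sum.elim_inl,
    Sum.elim_inr, Pi.zero_apply, neg_mul, Finset.sum_neg_distrib, hin, hout]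
  rw [sum_fin_succ_sub_castSucc fun k => if k = l then (T (-(q : ℤ)) : ℤ[T;T⁻¹]) else 0]
  exact add_neg_cancel _

/-- The pieces of a closed braid, matched with its Wirtinger relators: a letter and a position
give the piece above that letter, a closing relator gives a piece at level `0`. -/
def relatorEquivPiece {m : ℕ} (w : BraidWord m) :
    (Fin w.length × Fin (m + 1)) ⊕ Fin (m + 1) ≃ Piece w :=
  Equiv.ofBijective (Sum.elim (fun kp => (kp.1.succ, kp.2)) fun p => (0, p)) <| by
    refine (Fintype.bijective_iff_injective_and_card _).2 ⟨?_, ?_⟩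
    · refine Function.Injective.sumElim ?_ ?_ ?_
      · rintro ⟨k, p⟩ ⟨k', p'⟩ h
        simpa using h
      · intro p p' h
        simpa using h
      · rintro ⟨k, p⟩ p' h
        exact Fin.succ_ne_zero k (congrArg Prod.fst h)
    · simp [Piece]; ring

@[simp] theorem relatorEquivPiece_inl {m : ℕ} (w : BraidWord m) (k : Fin w.length)
    (p : Fin (m + 1)) : relatorEquivPiece w (.inl (k, p)) = (k.succ, p) := rfl

@[simp] theorem relatorEquivPiece_inr {m : ℕ} (w : BraidWord m) (p : Fin (m + 1)) :
    relatorEquivPiece w (.inr p) = (0, p) := rfl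

theorem det_toBlocks₁₁_alexanderMatrix {m : ℕ} (w : BraidWord m) :
    (((alexanderMatrix (wirtingerRelator w)).submatrix id (relatorEquivPiece w)).toBlocks₁₁).det
      = 1 := by
  set D := ((alexanderMatrix (wirtingerRelator w)).submatrix id (relatorEquivPiece w)).toBlocks₁₁
  have hD : ∀ k p k' p', D (k, p) (k', p') =
      (if k.succ = k'.succ then (1 : Matrix _ _ ℤ[T;T⁻¹]) p p' else 0)
        - (if k.castSucc = k'.succ then burauLetter (w.get k) p p' else 0) :=
    fun k p k' p' => alexanderMatrix_inl w k p k'.succ p'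
  rw [← Matrix.det_submatrix_equiv_self (ofLex : Fin w.length ×ₗ Fin (m + 1) ≃ _) D,
    Matrix.det_of_isLowerTriangular]
  · refine Finset.prod_eq_one fun x _ => ?_
    obtain ⟨k, p⟩ := x
    refine (hD k p k p).trans ?_
    rw [if_pos rfl, if_neg (castSucc_ne_succ k), Matrix.one_apply_eq, sub_zero]
  · rintro ⟨k, p⟩ ⟨k', p'⟩ h
    have h' : k < k' ∨ k = k' ∧ p < p' :=
      Prod.Lex.toLex_lt_toLex.1 (OrderDual.toDual_lt_toDual.1 h)
    refine (hD k p k' p').trans ?_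
    rw [if_neg (c := k.castSucc = k'.succ), sub_zero]
    · obtain h' | ⟨rfl, h'⟩ := h'
      · rw [if_neg]
        exact fun h0 => h'.ne (Fin.succ_injective _ h0)
      · rw [if_pos rfl, Matrix.one_apply_ne h'.ne]
    · intro h0
      have := congrArg Fin.val h0
      have h2 : (k : ℕ) ≤ k' := by obtain h' | ⟨rfl, -⟩ := h' <;> omega
      simp at this
      omega

/-- Eliminating the meridians above level `0` one letter at a time turns a cofactor of the
Alexander matrix into a cofactor of `burau w - 1`. -/
theorem adjugate_alexanderMatrix_inr_inr {m : ℕ} (w : BraidWord m) (q p : Fin (m + 1)) :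
    ((alexanderMatrix (wirtingerRelator w)).submatrix id (relatorEquivPiece w)).adjugate
      (.inr q) (.inr p) = (burau w - 1).adjugate q p := by
  set A := (alexanderMatrix (wirtingerRelator w)).submatrix id (relatorEquivPiece w) with hA
  -- column `q` of `W` lists the meridians of all pieces when the meridian `q` at level `0` is `1`
  -- and the others are `0`
  let W : Matrix (Piece w) (Fin (m + 1)) ℤ[T;T⁻¹] := Matrix.of fun y => burau (w.take y.1) y.2
  let V : Matrix (Fin w.length × Fin (m + 1)) (Fin (m + 1)) ℤ[T;T⁻¹] :=
    Matrix.of fun kp => W (kp.1.succ, kp.2)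
  have hAW : A * Matrix.fromRows V (1 : Matrix (Fin (m + 1)) (Fin (m + 1)) ℤ[T;T⁻¹]) =
      Matrix.fromRows 0 (burau w - 1) := by
    have hW : Matrix.fromRows V (1 : Matrix (Fin (m + 1)) (Fin (m + 1)) ℤ[T;T⁻¹]) =
        W.submatrix (relatorEquivPiece w) id := by
      ext (⟨k, p⟩ | p) q <;> simp [V, W, burau]
    rw [hW, hA, Matrix.submatrix_mul_equiv, Matrix.submatrix_id_id]
    ext (⟨k, p⟩ | p) q
    · simp only [Matrix.mul_apply, Fintype.sum_prod_type, alexanderMatrix_inl, sub_mul,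
        Finset.sum_sub_distrib, ite_mul, zero_mul]
      rw [Finset.sum_comm, Finset.sum_comm (γ := Fin (w.length + 1))]
      simp only [Finset.sum_ite_eq, Finset.mem_univ, if_true]
      have h := congrFun (congrFun (burau_take_succ w k) p) q
      rw [Matrix.mul_apply] at h
      simp [Matrix.one_apply, W, h]
    · simp only [Matrix.mul_apply, Fintype.sum_prod_type, alexanderMatrix_inr, sub_mul,
        Finset.sum_sub_distrib, ite_mul, zero_mul]
      rw [Finset.sum_comm, Finset.sum_comm (γ := Fin (w.length + 1))]
      simp [Matrix.one_apply, W, burau]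
  have hmul : A.updateRow (.inr p) (Pi.single (.inr q) 1) * Matrix.fromBlocks 1 V 0 1 =
      Matrix.fromBlocks A.toBlocks₁₁ 0
        (A.toBlocks₂₁.updateRow p 0) ((burau w - 1).updateRow p (Pi.single q 1)) := by
    rw [Matrix.updateRow_mul]
    have hAU : A * Matrix.fromBlocks 1 V 0 1 =
        Matrix.fromBlocks A.toBlocks₁₁ 0 A.toBlocks₂₁ (burau w - 1) := by
      rw [← Matrix.fromBlocks_toBlocks A, Matrix.fromBlocks_mul_fromRows,
        Matrix.fromRows_inj.eq_iff] at hAW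
      conv_lhs => rw [← Matrix.fromBlocks_toBlocks A, Matrix.fromBlocks_multiply]
      simp only [Matrix.mul_one] at hAW
      simp [hAW]
    rw [hAU]
    ext (x | x) (y | y) <;> simp [Matrix.updateRow_apply, Matrix.one_apply, Pi.single_apply, eq_comm]
  have hdet := congrArg Matrix.det hmul
  rw [Matrix.det_mul, Matrix.det_fromBlocks_zero₂₁, Matrix.det_fromBlocks_zero₁₂,
    det_toBlocks₁₁_alexanderMatrix] at hdet
  simpa [Matrix.adjugate_apply] using hdet

/-- The first elementary ideal of a closed braid is principal, generated by any cofactor of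
`burau w - 1`. -/
theorem alexanderIdeal_eq_span_adjugate {m : ℕ} (w : BraidWord m) (q p : Fin (m + 1)) :
    alexanderIdeal w = Ideal.span {(burau w - 1).adjugate q p} := by
  rw [← adjugate_alexanderMatrix_inr_inr]
  refine elementaryIdeal_one_eq_span_adjugate _ _ (alexanderMatrix_mulVec_one w) ?_
    (vecMul_alexanderMatrix w) _ _
  rintro (⟨k, p⟩ | p)
  · exact LaurentPolynomial.isUnit_T _
  · exact (LaurentPolynomial.isUnit_T _).neg

theorem isAlexanderPolynomial_of_associated_adjugate {m : ℕ} {w : BraidWord m} {Δ : ℤ[T;T⁻¹]}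
    (q p : Fin (m + 1)) (h : Associated ((burau w - 1).adjugate q p) Δ) :
    IsAlexanderPolynomial w Δ := by
  intro f
  rw [alexanderIdeal_eq_span_adjugate w q p, ← h.dvd_iff_dvd_right]
  refine ⟨fun hf g hg => hf.trans (Ideal.mem_span_singleton.1 hg), fun hf => ?_⟩
  exact hf _ (Ideal.mem_span_singleton_self _)

/-! ### The Burau matrix of the knots `K_n` -/

section FourStrands

variable {R : Type*} [CommRing R]

/-- The Burau matrices of `σ₁, σ₂, σ₃` on four strands, with `s` in place of `t⁻¹`. -/
def burauFour (s : R) : Fin 3 → Matrix (Fin 4) (Fin 4) R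
  | 0 => !![1 - s, s, 0, 0; 1, 0, 0, 0; 0, 0, 1, 0; 0, 0, 0, 1]
  | 1 => !![1, 0, 0, 0; 0, 1 - s, s, 0; 0, 1, 0, 0; 0, 0, 0, 1]
  | 2 => !![1, 0, 0, 0; 0, 1, 0, 0; 0, 0, 1 - s, s; 0, 0, 1, 0]

/-- `C - 1`, where `C` is the Burau matrix of the full twist `(σ₁σ₂)³`. -/
def fullTwistSubOne (s : R) : Matrix (Fin 4) (Fin 4) R :=
  !![s ^ 3 - s, s - s ^ 2, s ^ 2 - s ^ 3, 0; 1 - s, s ^ 3 - s ^ 2 + s - 1, s ^ 2 - s ^ 3, 0;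
    1 - s, s - s ^ 2, s ^ 2 - 1, 0; 0, 0, 0, 0]

theorem burauFour_one_mul_zero_pow_three (s : R) :
    (burauFour s 1 * burauFour s 0) ^ 3 = 1 + fullTwistSubOne s := by
  rw [pow_three]
  ext i j
  fin_cases i <;> fin_cases j <;>
    simp [burauFour, fullTwistSubOne, Matrix.mul_apply, Fin.sum_univ_four] <;> ring

/-- On three strands the full twist has the eigenvalues `1` and `s³` only. -/
theorem fullTwistSubOne_mul_self (s : R) :
    fullTwistSubOne s * fullTwistSubOne s = (s ^ 3 - 1) • fullTwistSubOne s := by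
  ext i j
  fin_cases i <;> fin_cases j <;>
    simp [fullTwistSubOne, Matrix.mul_apply, Fin.sum_univ_four] <;> ring

theorem one_add_fullTwistSubOne_pow (s : R) (n : ℕ) :
    (1 + fullTwistSubOne s) ^ n =
      1 + (∑ i ∈ Finset.range n, (s ^ 3) ^ i) • fullTwistSubOne s := by
  induction n with
  | zero => simp
  | succ n ih =>
    have hg := geom_sum_mul (s ^ 3) n
    rw [pow_succ, ih, mul_add, mul_one, add_mul, one_mul, smul_mul_assoc,
      fullTwistSubOne_mul_self, smul_smul, hg, Finset.sum_range_succ]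
    module

/-- The Burau matrix of `σ₃ σ₂ σ₂ σ₁ σ₃ σ₂ σ₂ σ₃ σ₂`. -/
def burauPrefix (s : R) : Matrix (Fin 4) (Fin 4) R :=
  !![1 - s, s - s ^ 2 + s ^ 3, s ^ 2 - 2 * s ^ 3 + s ^ 4, s ^ 3 - s ^ 4;
    1 - s, s - 2 * s ^ 2 + 2 * s ^ 3 - s ^ 4, 2 * s ^ 2 - 3 * s ^ 3 + 2 * s ^ 4 - s ^ 5,
      s ^ 3 - s ^ 4 + s ^ 5;
    1 - s + s ^ 2, s - 3 * s ^ 2 + 3 * s ^ 3 - s ^ 4,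
      2 * s ^ 2 - 4 * s ^ 3 + 3 * s ^ 4 - s ^ 5, s ^ 3 - 2 * s ^ 4 + s ^ 5;
    1 - s, s - 2 * s ^ 2 + s ^ 3, 2 * s ^ 2 - 2 * s ^ 3 + s ^ 4, s ^ 3 - s ^ 4]

theorem burauFour_prefix (s : R) :
    burauFour s 1 * (burauFour s 2 * (burauFour s 1 * (burauFour s 1 * (burauFour s 2 *
      (burauFour s 0 * (burauFour s 1 * (burauFour s 1 * burauFour s 2))))))) =
      burauPrefix s := by
  ext i j
  fin_cases i <;> fin_cases j <;>
    simp [burauFour, burauPrefix, Matrix.mul_apply, Fin.sum_univ_four] <;> ring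

/-- A cofactor of the Burau matrix of `K_n` minus the identity, where `g` stands for
`1 + s³ + ⋯ + s^(3(n-1))`, so that `1 + (s³ - 1) g = s^(3n)`. -/
theorem adjugate_fullTwist_mul_prefix (s g : R) :
    ((1 + g • fullTwistSubOne s) * burauPrefix s - 1).adjugate 3 3 =
      -s ^ 3 * ((1 + (s ^ 3 - 1) * g) ^ 2 * (s ^ 6 - s ^ 5)
        + (1 + (s ^ 3 - 1) * g) * (s ^ 5 - s ^ 4) * g + (1 + (s ^ 3 - 1) * g) * s ^ 3
        - (s ^ 5 - s ^ 4) * g - s + 1) := by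
  rw [Matrix.adjugate_fin_succ_eq_det_submatrix, Matrix.det_fin_three]
  have h : ∀ i j : Fin 4, ((1 + g • fullTwistSubOne s) * burauPrefix s - 1) i j =
    burauPrefix s i j + g * (∑ k, fullTwistSubOne s i k * burauPrefix s k j)
      - (1 : Matrix _ _ R) i j := fun i j => by
    simp [add_mul, Matrix.mul_apply]
  simp only [Matrix.submatrix_apply, h]
  simp [fullTwistSubOne, burauPrefix, Fin.sum_univ_four, Fin.succAbove]
  ring

end FourStrands

theorem burauLetter_true (i : Fin 3) :
    burauLetter (i, true) = burauFour (T (-1) : ℤ[T;T⁻¹]) i := by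
  ext p q
  fin_cases i <;> fin_cases p <;> fin_cases q <;> simp [burauLetter, burauFour]

theorem burau_fullTwists (n : ℕ) :
    burau (positiveWord (List.replicate (3 * n) [0, 1]).flatten) =
      (1 + fullTwistSubOne (T (-1) : ℤ[T;T⁻¹])) ^ n := by
  rw [← burauFour_one_mul_zero_pow_three, ← pow_mul]
  generalize 3 * n = k
  induction k with
  | zero => simp [positiveWord, burau]
  | succ k ih =>
    rw [pow_succ, ← ih]
    simp [positiveWord, List.replicate_succ, burau, burauLetter_true, mul_assoc]

theorem burau_knotK (n : ℕ) :
    burau (knotK n) = (1 + (∑ i ∈ Finset.range n, ((T (-1) : ℤ[T;T⁻¹]) ^ 3) ^ i) •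
      fullTwistSubOne (T (-1))) * burauPrefix (T (-1)) := by
  have hp : burau (positiveWord [2, 1, 1, 0, 2, 1, 1, 2, 1]) = burauPrefix (T (-1)) := by
    rw [← burauFour_prefix]
    simp only [positiveWord, List.map_cons, List.map_nil, burau, burauLetter_true, Matrix.one_mul,
      Matrix.mul_assoc]
  have happ : knotK n = positiveWord [2, 1, 1, 0, 2, 1, 1, 2, 1] ++
      positiveWord (List.replicate (3 * n) [0, 1]).flatten := List.map_append
  rw [happ, burau_append, burau_fullTwists, hp, one_add_fullTwistSubOne_pow]

/-- Reversing a geometric sum: `(1 + x + ⋯ + x^(n-1)) yⁿ = y (1 + y + ⋯ + y^(n-1))` when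
`y = x⁻¹`. -/
theorem geom_sum_mul_pow_of_mul_eq_one {R : Type*} [CommRing R] {x y : R} (h : y * x = 1) (n : ℕ) :
    (∑ i ∈ Finset.range n, x ^ i) * y ^ n = y * ∑ i ∈ Finset.range n, y ^ i := by
  induction n with
  | zero => simp
  | succ n ih =>
    have hp : y ^ n * x ^ n = 1 := by rw [← mul_pow, h, one_pow]
    rw [geom_sum_succ (x := y), Finset.sum_range_succ, pow_succ]
    linear_combination y * ih + y * hp

/-- The polynomial of the statement is palindromic of degree `6n + 6`: its value at `s = t⁻¹`,
multiplied by `t^(6n+6)`, is its value at `t`. -/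
theorem alexander_formula_palindromic {R : Type*} [CommRing R] {s t : R} (hst : t * s = 1) (n : ℕ)
    {g : R} (hg : g = ∑ i ∈ Finset.range n, (s ^ 3) ^ i) :
    ((1 + (s ^ 3 - 1) * g) ^ 2 * (s ^ 6 - s ^ 5)
      + (1 + (s ^ 3 - 1) * g) * (s ^ 5 - s ^ 4) * g + (1 + (s ^ 3 - 1) * g) * s ^ 3
      - (s ^ 5 - s ^ 4) * g - s + 1) * t ^ (6 * n + 6) =
    (t ^ (6 * n + 6) - t ^ (6 * n + 5))
      + ∑ i ∈ Finset.range n, (t ^ (3 * n + 3 * i + 5) - t ^ (3 * n + 3 * i + 4))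
      + t ^ (3 * n + 3) - ∑ i ∈ Finset.range n, (t ^ (3 * i + 5) - t ^ (3 * i + 4)) - t + 1 := by
  set h := ∑ i ∈ Finset.range n, (t ^ 3) ^ i with hh
  have h1 : ∑ i ∈ Finset.range n, (t ^ (3 * n + 3 * i + 5) - t ^ (3 * n + 3 * i + 4)) =
      (t ^ 3) ^ n * (t ^ 5 - t ^ 4) * h := by
    rw [hh, Finset.mul_sum]
    exact Finset.sum_congr rfl fun i _ => by ring
  have h2 : ∑ i ∈ Finset.range n, (t ^ (3 * i + 5) - t ^ (3 * i + 4)) = (t ^ 5 - t ^ 4) * h := by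
    rw [hh, Finset.mul_sum]
    exact Finset.sum_congr rfl fun i _ => by ring
  have h3 : t ^ 3 * s ^ 3 = 1 := by rw [← mul_pow, hst, one_pow]
  have hgu : g * (t ^ 3) ^ n = t ^ 3 * h := hg ▸ geom_sum_mul_pow_of_mul_eq_one h3 n
  have hv : 1 + (s ^ 3 - 1) * g = (s ^ 3) ^ n := by
    rw [hg, mul_comm, geom_sum_mul]; ring
  have huv : (t ^ 3) ^ n * (s ^ 3) ^ n = 1 := by rw [← mul_pow, h3, one_pow]
  have e6 : s ^ 6 * t ^ 6 = 1 := by rw [← mul_pow, mul_comm, hst, one_pow]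
  have e5 : s ^ 5 * t ^ 6 = t := by linear_combination t * e6 - s ^ 5 * t ^ 6 * hst
  have e4 : s ^ 4 * t ^ 6 = t ^ 2 := by linear_combination t * e5 - s ^ 4 * t ^ 6 * hst
  have e3 : s ^ 3 * t ^ 6 = t ^ 3 := by linear_combination t * e4 - s ^ 3 * t ^ 6 * hst
  have e1 : s * t ^ 6 = t ^ 5 := by linear_combination t ^ 5 * hst
  rw [h1, h2, hv, show t ^ (6 * n + 6) = ((t ^ 3) ^ n) ^ 2 * t ^ 6 by ring,
    show t ^ (6 * n + 5) = ((t ^ 3) ^ n) ^ 2 * t ^ 5 by ring,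
    show t ^ (3 * n + 3) = (t ^ 3) ^ n * t ^ 3 by ring]
  generalize (t ^ 3) ^ n = u at *
  generalize (s ^ 3) ^ n = v at *
  calc _ = (u * v) ^ 2 * (s ^ 6 * t ^ 6 - s ^ 5 * t ^ 6)
        + (u * v) * (g * u) * (s ^ 5 * t ^ 6 - s ^ 4 * t ^ 6) + (u * v) * u * (s ^ 3 * t ^ 6)
        - (g * u) * u * (s ^ 5 * t ^ 6 - s ^ 4 * t ^ 6) - u ^ 2 * (s * t ^ 6) + u ^ 2 * t ^ 6 := by
        ring
    _ = _ := by
      rw [huv, hgu, e6, e5, e4, e3, e1]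
      ring

end

end KnotTheory


theorem lemma4p1 (n : ℕ) (hn : 1 ≤ n) :
    KnotTheory.IsAlexanderPolynomial (KnotTheory.knotK n)
      (Polynomial.toLaurent
        ((Polynomial.X ^ (6 * n + 6) - Polynomial.X ^ (6 * n + 5))
          + ∑ i ∈ Finset.range n,
              (Polynomial.X ^ (3 * n + 3 * i + 5) - Polynomial.X ^ (3 * n + 3 * i + 4))
          + Polynomial.X ^ (3 * n + 3)
          - ∑ i ∈ Finset.range n,
              (Polynomial.X ^ (3 * i + 5) - Polynomial.X ^ (3 * i + 4))
          - Polynomial.X + 1 : ℤ[X])) := by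
  open KnotTheory in
  refine isAlexanderPolynomial_of_associated_adjugate 3 3 ?_
  rw [burau_knotK, adjugate_fullTwist_mul_prefix, neg_mul, Associated.neg_left_iff]
  have ht : IsUnit (LaurentPolynomial.T 1 : ℤ[T;T⁻¹]) := LaurentPolynomial.isUnit_T 1
  have hs : IsUnit (LaurentPolynomial.T (-1) : ℤ[T;T⁻¹]) := LaurentPolynomial.isUnit_T (-1)
  refine (associated_unit_mul_left _ _ (hs.pow 3)).trans ?_
  refine (associated_mul_unit_right _ _ (ht.pow (6 * n + 6))).trans ?_
  rw [alexander_formula_palindromic T_mul_T_neg_one n rfl]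
  simp only [map_add, map_sub, map_sum, map_pow, map_one, Polynomial.toLaurent_X]
  exact Associated.refl _
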